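/- There are $n$ players and $k$ arms. A stochastic bandit $\mathbf D=(D_1,\dots,D_k)$ assigns to each arm $i$ a reward distribution $D_i$ supported on $[-1,1]$ with mean $\mu_i$, such that the arm with the highest mean $\mu^*=\max_i\mu_i$ is unique. A policy maps each history of all players' actions and rewards in the first $t$ rounds to a distribution over the arms, from which the player draws her arm in round $t+1$; pulling arm $i$ yields a reward drawn from $D_i$. In each round, the players' random choices and rewards are drawn independently of each other given the history. The policy of player $p$ is self-reliant if it depends only on $p$'s own past actions and rewards. For a policy profile $\mathbf f=(f_1,\dots,f_n)$, let $R_p^T(\mathbf D,\mathbf f)=T\mu^*-\sum_{t=1}^T\mathbb E[r_p^t]$ be the regret of player $p$, where $r_p^t$ is the reward of $p$ in round $t$, and let $N_{p,i}^T(\mathbf D,\mathbf f)$ be the number of times $p$ pulls arm $i$ in the first $T$ rounds. Theorem. Let $\varepsilon>0$, let $\mathbf f$ be a policy profile and let $p$ be a player whose policy $f_p$ is self-reliant. Suppose that for every $k$-arm stochastic bandit $\mathbf D$, $R_p^T(\mathbf D,\mathbf f)=O(T^{1-\varepsilon})$ as $T\to\infty$. Then for every $k$-arm stochastic bandit $\mathbf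 D$ with $\mu^*<1$ and every arm $i\in[k]$, $\mathbb E[N_{p,i}^T(\mathbf D,\mathbf f)]=\Omega(\log T)$ as $T\to\infty$. The implied constants may depend on $\mathbf D$ (and on $\mathbf f$, $\varepsilon$, $p$, $i$). -/

import Mathlib

open MeasureTheory ProbabilityTheory Filter Asymptotics

noncomputable section

/-- A stochastic bandit with `k` arms: every arm has a reward distribution supported on `[-1, 1]`,
and the arm with the highest mean reward is unique. -/
structure StochasticBandit (k : ℕ) where
  /-- the reward distribution of each arm -/
  reward : Fin k → Measure ℝ
  isProb : ∀ i, IsProbabilityMeasure (reward i)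
  support : ∀ i, ∀ᵐ x ∂(reward i), x ∈ Set.Icc (-1 : ℝ) 1
  unique_best : ∃ i, ∀ j, j ≠ i → ∫ x, x ∂(reward j) < ∫ x, x ∂(reward i)

namespace StochasticBandit

variable {k : ℕ}

/-- The mean reward of arm `i`. -/
def mean (D : StochasticBandit k) (i : Fin k) : ℝ := ∫ x, x ∂(D.reward i)

/-- The highest mean reward (a supremum over finitely many arms; there is at least one arm). -/
def bestMean (D : StochasticBandit k) : ℝ := ⨆ i, D.mean i

/-- The reward distributions as a kernel from arms to rewards. -/
def rewardKernel (D : StochasticBandit k) : Kernel (Fin k) ℝ where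
  toFun := D.reward
  measurable' := measurable_of_finite _

instance (D : StochasticBandit k) : IsMarkovKernel D.rewardKernel := ⟨D.isProb⟩

end StochasticBandit

/-- Histories of the first `t` rounds with `n` players and `k` arms: `h s p` is the pair consisting
of the arm pulled and the reward received by player `p` in round `s + 1`. -/
abbrev History (n k t : ℕ) : Type := Fin t → Fin n → Fin k × ℝ

/-- A (possibly randomized) policy maps each history of any length `t` to a distribution over the
arms, measurably in the history; the arm of round `t + 1` is drawn from it. -/
structure Policy (n k : ℕ) where
  choice : (t : ℕ) → Kernel (History n k t) (Fin k)
  isMarkov : ∀ t, IsMarkovKernel (choice t)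

attribute [instance] Policy.isMarkov

/-- The policy `f` of player `p` is self-reliant: it depends only on `p`'s own actions and rewards. -/
def Policy.SelfReliant {n k : ℕ} (f : Policy n k) (p : Fin n) : Prop :=
  ∀ (t : ℕ) (h h' : History n k t), (∀ s, h s p = h' s p) → f.choice t h = f.choice t h'

section Play

variable {n k : ℕ} (D : StochasticBandit k) (F : Fin n → Policy n k)

theorem measurable_roundLaw (t : ℕ) : Measurable fun h : History n k t =>
    Measure.pi fun p => (F p).choice t h ⊗ₘ D.rewardKernel := by
  refine Measurable.measure_of_isPiSystem_of_isProbabilityMeasure generateFrom_pi.symm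
    isPiSystem_pi ?_
  rintro _ ⟨s, hs, rfl⟩
  simp only [Measure.pi_pi]
  refine Finset.measurable_prod _ fun p _ => ?_
  have hp : MeasurableSet (s p) := hs p (Set.mem_univ p)
  simp only [Measure.compProd_apply hp]
  exact (Measure.measurable_lintegral (Kernel.measurable_kernel_prodMk_left hp)).comp
    ((F p).choice t).measurable

/-- Given the history of the first `t` rounds, in round `t + 1` every player draws an arm from her
policy and then a reward from that arm's distribution, independently of the other players. -/
def roundKernel (t : ℕ) : Kernel (History n k t) (Fin n → Fin k × ℝ) where
  toFun h := Measure.pi fun p => (F p).choice t h ⊗ₘ D.rewardKernel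
  measurable' := measurable_roundLaw D F t

instance (t : ℕ) : IsMarkovKernel (roundKernel D F t) :=
  ⟨fun h => inferInstanceAs (IsProbabilityMeasure
    (Measure.pi fun p => (F p).choice t h ⊗ₘ D.rewardKernel))⟩

/-- Appending one round to a history. -/
def History.extend {t : ℕ} (x : History n k t × (Fin n → Fin k × ℝ)) : History n k (t + 1) :=
  Fin.snoc (α := fun _ => Fin n → Fin k × ℝ) x.1 x.2

theorem History.measurable_extend {t : ℕ} :
    Measurable (History.extend : History n k t × (Fin n → Fin k × ℝ) → History n k (t + 1)) := by
  refine measurable_pi_iff.2 fun s => ?_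
  refine Fin.lastCases ?_ (fun s => ?_) s
  · simpa [History.extend] using measurable_snd
  · simp only [History.extend, Fin.snoc_castSucc]
    exact (measurable_pi_apply s).comp measurable_fst

/-- The distribution, determined by the bandit `D` and the policy profile `F`, of the history of
the first `T` rounds. -/
def historyLaw : (T : ℕ) → Measure (History n k T)
  | 0 => Measure.dirac Fin.elim0
  | t + 1 => (historyLaw t ⊗ₘ roundKernel D F t).map History.extend

instance historyLaw.isProbabilityMeasure (T : ℕ) : IsProbabilityMeasure (historyLaw D F T) := by
  induction T with
  | zero => exact inferInstanceAs (IsProbabilityMeasure (Measure.dirac _))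
  | succ t ih =>
    exact Measure.isProbabilityMeasure_map
      (μ := historyLaw D F t ⊗ₘ roundKernel D F t) History.measurable_extend.aemeasurable

/-- The regret of player `p` at time `T`: `T μ* - ∑ₜ E[rₚᵗ]`. -/
def regret (p : Fin n) (T : ℕ) : ℝ :=
  (T : ℝ) * D.bestMean - ∑ t : Fin T, ∫ h, (h t p).2 ∂(historyLaw D F T)

/-- The number of times that player `p` pulled arm `i` in the history `h`. -/
def sampleCount {T : ℕ} (h : History n k T) (p : Fin n) (i : Fin k) : ℕ :=
  (Finset.univ.filter fun t : Fin T => (h t p).1 = i).card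

/-- The expected number of times that player `p` pulls arm `i` in the first `T` rounds. -/
def expectedSampleCount (p : Fin n) (i : Fin k) (T : ℕ) : ℝ :=
  ∫ h, (sampleCount h p i : ℝ) ∂(historyLaw D F T)

end Play

end

/-! Mixing the rewards of arm `i` with a large atom at `1` turns `D` into a bandit `D'` in which `i`
is the best arm, while the reward distribution of `i` under `D` is at most `c` times that under `D'`
for some constant `c > 1`. Because the policy of `p` is self-reliant, the law of her own actions and
rewards is built from her policy and the bandit alone, so the likelihood ratio of her own past
between `D` and `D'` is at most `c ^ N`, where `N` counts only *her* pulls of `i`: those of the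
other players do not enter it.

Low regret in `D'` forces `P'(N ≤ m) = O(T ^ (-ε))` for every `m = o(T)`, by Markov's inequality.
For `m = δ log_c T` with `δ < ε`, returning to `D` costs a factor of at most `c ^ m = T ^ δ`, so
`P(N ≤ m) → 0` and hence `E[N] ≥ m / 2` for all large `T`.
-/

open scoped ENNReal NNReal Topology

section SequentialLaw

variable {α β : Type*} [MeasurableSpace α] [MeasurableSpace β]

theorem measurable_snoc {t : ℕ} :
    Measurable fun x : (Fin t → α) × α => (Fin.snoc x.1 x.2 : Fin (t + 1) → α) := by
  refine measurable_pi_iff.2 (Fin.lastCases ?_ fun s => ?_)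
  · simpa only [Fin.snoc_last] using measurable_snd
  · simpa only [Fin.snoc_castSucc] using measurable_fst.eval

/-- The law of the first `T` terms of a random sequence in which the term of index `t` is drawn
from `κ t`, given the terms of index `< t`. -/
noncomputable def sequentialLaw (κ : ∀ t : ℕ, Kernel (Fin t → α) α) : ∀ T : ℕ, Measure (Fin T → α)
  | 0 => Measure.dirac Fin.elim0
  | t + 1 => (sequentialLaw κ t ⊗ₘ κ t).map fun x => Fin.snoc x.1 x.2

variable (κ : ∀ t : ℕ, Kernel (Fin t → α) α) [∀ t, IsMarkovKernel (κ t)]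
  (η : ∀ t : ℕ, Kernel (Fin t → β) β) [∀ t, IsMarkovKernel (η t)]

instance (T : ℕ) : IsProbabilityMeasure (sequentialLaw κ T) := by
  induction T with
  | zero => exact Measure.dirac.isProbabilityMeasure
  | succ t ih => exact Measure.isProbabilityMeasure_map measurable_snoc.aemeasurable

theorem lintegral_sequentialLaw_succ (t : ℕ) {f : (Fin (t + 1) → α) → ℝ≥0∞} (hf : Measurable f) :
    ∫⁻ y, f y ∂sequentialLaw κ (t + 1) =
      ∫⁻ y, ∫⁻ x, f (Fin.snoc y x) ∂κ t y ∂sequentialLaw κ t := by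
  rw [sequentialLaw, lintegral_map hf measurable_snoc]
  exact Measure.lintegral_compProd (hf.comp measurable_snoc)

theorem map_eval_sequentialLaw {T : ℕ} (t : Fin T) :
    (sequentialLaw κ T).map (fun y => y t) = κ t ∘ₘ sequentialLaw κ t := by
  induction T with
  | zero => exact t.elim0
  | succ T ih =>
    rw [sequentialLaw, Measure.map_map (measurable_pi_apply t) measurable_snoc]
    induction t using Fin.lastCases with
    | last =>
      simp only [Function.comp_def, Fin.snoc_last, Fin.val_last]
      exact Measure.snd_compProd _ _
    | cast s =>
      simp only [Function.comp_def, Fin.snoc_castSucc, Fin.val_castSucc]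
      calc (sequentialLaw κ T ⊗ₘ κ T).map (fun x => x.1 s)
          = (sequentialLaw κ T ⊗ₘ κ T).fst.map (fun y => y s) :=
            (Measure.map_map (measurable_pi_apply s) measurable_fst).symm
        _ = κ s ∘ₘ sequentialLaw κ s := by rw [Measure.fst_compProd, ih s]

variable {κ η}

theorem map_comp_sequentialLaw {g : α → β} (hg : Measurable g)
    (hκη : ∀ t y, (κ t y).map g = η t (g ∘ y)) (T : ℕ) :
    (sequentialLaw κ T).map (g ∘ ·) = sequentialLaw η T := by
  have hg_comp (t : ℕ) : Measurable fun y : Fin t → α => g ∘ y := by fun_prop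
  induction T with
  | zero =>
    simp only [sequentialLaw, Measure.map_dirac' (hg_comp 0)]
    congr
    exact Subsingleton.elim _ _
  | succ t ih =>
    refine Measure.ext_of_lintegral _ fun f hf => ?_
    have hf_snoc (z : Fin t → β) : Measurable fun x => f (Fin.snoc z x) :=
      hf.comp (measurable_snoc.comp measurable_prodMk_left)
    have hf_inner : Measurable fun z : Fin t → β => ∫⁻ x, f (Fin.snoc z x) ∂η t z :=
      (hf.comp measurable_snoc).lintegral_kernel_prod_right'
    calc ∫⁻ z, f z ∂(sequentialLaw κ (t + 1)).map (g ∘ ·)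
        = ∫⁻ y, ∫⁻ x, f (g ∘ Fin.snoc y x) ∂κ t y ∂sequentialLaw κ t := by
          rw [lintegral_map hf (hg_comp _)]
          exact lintegral_sequentialLaw_succ κ t (hf.comp (hg_comp _))
      _ = ∫⁻ y, ∫⁻ x, f (Fin.snoc (g ∘ y) x) ∂η t (g ∘ y) ∂sequentialLaw κ t := by
          simp only [Fin.comp_snoc, ← hκη, lintegral_map (hf_snoc _) hg]
      _ = ∫⁻ z, f z ∂sequentialLaw η (t + 1) := by
          rw [lintegral_sequentialLaw_succ η t hf, ← ih, lintegral_map hf_inner (hg_comp t)]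

theorem sequentialLaw_le_withDensity {κ' : ∀ t : ℕ, Kernel (Fin t → α) α}
    [∀ t, IsMarkovKernel (κ' t)] {w : α → ℝ≥0∞} (hw : Measurable w)
    (hκ : ∀ t y, κ t y ≤ (κ' t y).withDensity w) (T : ℕ) :
    sequentialLaw κ T ≤ (sequentialLaw κ' T).withDensity fun y => ∏ s, w (y s) := by
  have hw_prod (t : ℕ) : Measurable fun y : Fin t → α => ∏ s, w (y s) := by fun_prop
  induction T with
  | zero => simp [sequentialLaw]
  | succ t ih =>
    refine Measure.le_intro fun A hA _ => ?_
    set f : (Fin (t + 1) → α) → ℝ≥0∞ := A.indicator 1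
    have hf : Measurable f := measurable_one.indicator hA
    have hf_snoc (y : Fin t → α) : Measurable fun x => f (Fin.snoc y x) :=
      hf.comp (measurable_snoc.comp measurable_prodMk_left)
    have hwf : Measurable fun y : Fin t → α => ∫⁻ x, w x * f (Fin.snoc y x) ∂κ' t y :=
      ((hw.comp measurable_snd).mul (hf.comp measurable_snoc)).lintegral_kernel_prod_right'
    calc sequentialLaw κ (t + 1) A
        = ∫⁻ y, ∫⁻ x, f (Fin.snoc y x) ∂κ t y ∂sequentialLaw κ t := by
          rw [← lintegral_indicator_one hA, lintegral_sequentialLaw_succ κ t hf]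
      _ ≤ ∫⁻ y, ∫⁻ x, w x * f (Fin.snoc y x) ∂κ' t y ∂sequentialLaw κ t := by
          refine lintegral_mono fun y => (lintegral_mono' (hκ t y) le_rfl).trans_eq ?_
          exact lintegral_withDensity_eq_lintegral_mul _ hw (hf_snoc y)
      _ ≤ ∫⁻ y, (∏ s, w (y s)) * ∫⁻ x, w x * f (Fin.snoc y x) ∂κ' t y ∂sequentialLaw κ' t :=
          (lintegral_mono' ih le_rfl).trans_eq <|
            lintegral_withDensity_eq_lintegral_mul _ (hw_prod t) hwf
      _ = ∫⁻ y, (∏ s, w (y s)) * f y ∂sequentialLaw κ' (t + 1) := by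
          rw [lintegral_sequentialLaw_succ κ' t (by fun_prop)]
          refine lintegral_congr fun y => ?_
          simp only [Fin.prod_univ_castSucc, Fin.snoc_castSucc, Fin.snoc_last, mul_assoc]
          exact (lintegral_const_mul _ (hw.mul (hf_snoc y))).symm
      _ = ((sequentialLaw κ' (t + 1)).withDensity fun y => ∏ s, w (y s)) A := by
          rw [← lintegral_indicator_one hA]
          exact (lintegral_withDensity_eq_lintegral_mul _ (hw_prod _) hf).symm

end SequentialLaw

theorem compProd_le_withDensity {α β : Type*} [MeasurableSpace α] [MeasurableSpace β]
    (μ : Measure α) [SFinite μ] {κ η : Kernel α β} [IsSFiniteKernel κ] [IsSFiniteKernel η]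
    {v : α → ℝ≥0∞} (hv : Measurable v) (hκ : ∀ a, κ a ≤ v a • η a) :
    μ ⊗ₘ κ ≤ (μ ⊗ₘ η).withDensity fun x => v x.1 := by
  refine Measure.le_intro fun A hA _ => ?_
  have hv_fst : Measurable fun x : α × β => v x.1 := hv.comp measurable_fst
  rw [Measure.compProd_apply hA, withDensity_apply _ hA, ← lintegral_indicator hA,
    Measure.lintegral_compProd (hv_fst.indicator hA)]
  refine lintegral_mono fun a => (hκ a _).trans_eq ?_
  calc v a * η a (Prod.mk a ⁻¹' A) = ∫⁻ b, (Prod.mk a ⁻¹' A).indicator (fun _ => v a) b ∂η a :=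
        (lintegral_indicator_const (measurable_prodMk_left hA) _).symm
    _ = ∫⁻ b, A.indicator (fun x => v x.1) (a, b) ∂η a := rfl

namespace StochasticBandit

variable {k : ℕ} (D : StochasticBandit k)

instance (i : Fin k) : IsProbabilityMeasure (D.reward i) := D.isProb i

theorem mean_le_bestMean (i : Fin k) : D.mean i ≤ D.bestMean :=
  le_ciSup (Set.finite_range D.mean).bddAbove i

theorem integrable_reward (i : Fin k) : Integrable (fun r : ℝ => r) (D.reward i) :=
  Integrable.of_mem_Icc (-1) 1 aemeasurable_id (D.support i)

variable {D} in
theorem exists_pos_forall_mean_add_le {i : Fin k} (hi : ∀ j, j ≠ i → D.mean j < D.mean i) :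
    ∃ Δ : ℝ, 0 < Δ ∧ ∀ j, j ≠ i → D.mean j + Δ ≤ D.mean i := by
  have hgap : ∀ᶠ Δ : ℝ in 𝓝[>] 0, ∀ j, j ≠ i → D.mean j + Δ ≤ D.mean i := by
    refine eventually_all.2 fun j => eventually_imp_distrib_left.2 fun hj => ?_
    filter_upwards [Ioo_mem_nhdsGT (sub_pos.2 (hi j hj))] with Δ hΔ
    linarith [hΔ.2]
  exact (eventually_mem_nhdsWithin.and hgap).exists

/-- The bandit obtained from `D` by giving arm `i` the reward distribution `ν`, whose mean exceeds
the means of all other arms. -/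
def replaceArm (i : Fin k) (ν : Measure ℝ) [IsProbabilityMeasure ν]
    (hsupp : ∀ᵐ r ∂ν, r ∈ Set.Icc (-1 : ℝ) 1) (hbest : ∀ j, j ≠ i → D.mean j < ∫ r, r ∂ν) :
    StochasticBandit k where
  reward := Function.update D.reward i ν
  isProb := Function.forall_update_iff D.reward (fun _ => IsProbabilityMeasure) |>.2
    ⟨inferInstance, fun j _ => D.isProb j⟩
  support := Function.forall_update_iff D.reward (fun _ ρ => ∀ᵐ r ∂ρ, r ∈ Set.Icc (-1 : ℝ) 1) |>.2
    ⟨hsupp, fun j _ => D.support j⟩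
  unique_best := ⟨i, fun j hj => by
    simpa only [Function.update_self, Function.update_of_ne hj, mean] using hbest j hj⟩

open unitInterval in
theorem integral_mix_dirac_one (i : Fin k) (q : I) :
    ∫ r, r ∂(toNNReal q • D.reward i + toNNReal (σ q) • Measure.dirac (1 : ℝ)) =
      q * D.mean i + (1 - q) := by
  rw [integral_add_measure ((D.integrable_reward i).smul_measure_nnreal)
    ((integrable_dirac (by simp)).smul_measure_nnreal), integral_smul_nnreal_measure,
    integral_smul_nnreal_measure, integral_dirac]
  simp [mean, NNReal.smul_def]

open unitInterval in
theorem ae_mix_dirac_one_mem_Icc (i : Fin k) (q : I) :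
    ∀ᵐ r ∂(toNNReal q • D.reward i + toNNReal (σ q) • Measure.dirac (1 : ℝ)),
      r ∈ Set.Icc (-1 : ℝ) 1 :=
  ae_add_measure_iff.2 ⟨Measure.ae_smul_measure (D.support i) _,
    Measure.ae_smul_measure ((ae_dirac_iff measurableSet_Icc).2 (by norm_num)) _⟩

variable {D} in
open unitInterval in
theorem exists_dominating_bandit (hD : D.bestMean < 1) (i : Fin k) :
    ∃ (D' : StochasticBandit k) (c : ℝ≥0), 1 < c ∧ (∀ j, j ≠ i → D'.mean j < D'.mean i) ∧
      D.reward i ≤ c • D'.reward i ∧ ∀ j, j ≠ i → D.reward j = D'.reward j := by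
  have hmix : Tendsto (fun q : ℝ => q * D.mean i + (1 - q)) (𝓝[>] 0) (𝓝 1) := by
    refine tendsto_nhdsWithin_of_tendsto_nhds (Continuous.tendsto' (by fun_prop) _ _ ?_)
    norm_num
  obtain ⟨q, hq_mean, hq0, hq1⟩ :=
    ((hmix.eventually_const_lt hD).and (Ioo_mem_nhdsGT zero_lt_one)).exists
  lift q to I using ⟨hq0.le, hq1.le⟩
  have hbest : ∀ j, j ≠ i → D.mean j <
      ∫ r, r ∂(toNNReal q • D.reward i + toNNReal (σ q) • Measure.dirac (1 : ℝ)) := fun j _ => by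
    rw [D.integral_mix_dirac_one i q]
    exact (D.mean_le_bestMean j).trans_lt hq_mean
  have hq : 0 < toNNReal q := hq0
  refine ⟨D.replaceArm i _ (D.ae_mix_dirac_one_mem_Icc i q) hbest, (toNNReal q)⁻¹,
    (one_lt_inv₀ hq).2 hq1, fun j hj => ?_, ?_, fun j hj => ?_⟩
  · simpa only [mean, replaceArm, Function.update_self, Function.update_of_ne hj]
      using hbest j hj
  · simp only [replaceArm, Function.update_self, smul_add, inv_smul_smul₀ hq.ne']
    exact Measure.le_add_right le_rfl
  · simp only [replaceArm, Function.update_of_ne hj]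

end StochasticBandit

section Play

variable {n k : ℕ} (D : StochasticBandit k) (F : Fin n → Policy n k) (p : Fin n)

theorem historyLaw_eq_sequentialLaw (T : ℕ) :
    historyLaw D F T = sequentialLaw (roundKernel D F) T := by
  induction T with
  | zero => rfl
  | succ t ih => rw [historyLaw, ih]; rfl

theorem map_eval_roundKernel {t : ℕ} (h : History n k t) :
    (roundKernel D F t h).map (fun x => x p) = (F p).choice t h ⊗ₘ D.rewardKernel :=
  (measurePreserving_eval (fun q => (F q).choice t h ⊗ₘ D.rewardKernel) p).map_eq

theorem map_round_historyLaw {T : ℕ} (t : Fin T) :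
    (historyLaw D F T).map (fun h => h t p) =
      ((F p).choice t ∘ₘ historyLaw D F t) ⊗ₘ D.rewardKernel := by
  have hround : Measurable fun h : History n k T => h t := measurable_pi_apply t
  refine Measure.ext_of_lintegral _ fun f hf => ?_
  have hf_p : Measurable fun x : Fin n → Fin k × ℝ => f (x p) := hf.comp (measurable_pi_apply p)
  calc ∫⁻ z, f z ∂(historyLaw D F T).map (fun h => h t p)
      = ∫⁻ x, f (x p) ∂(roundKernel D F t ∘ₘ historyLaw D F t) := by
        rw [lintegral_map hf hround.eval, historyLaw_eq_sequentialLaw,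
          historyLaw_eq_sequentialLaw, ← map_eval_sequentialLaw, lintegral_map hf_p hround]
    _ = ∫⁻ h, ∫⁻ z, f z ∂((F p).choice t h ⊗ₘ D.rewardKernel) ∂historyLaw D F t := by
        rw [Measure.lintegral_bind (Kernel.aemeasurable _) hf_p.aemeasurable]
        exact lintegral_congr fun h => by
          rw [← map_eval_roundKernel, lintegral_map hf (measurable_pi_apply p)]
    _ = ∫⁻ z, f z ∂(((F p).choice t ∘ₘ historyLaw D F t) ⊗ₘ D.rewardKernel) := by
        rw [Measure.lintegral_compProd hf, Measure.lintegral_bind (Kernel.aemeasurable _)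
          (measurable_of_finite _).aemeasurable]
        simp only [Measure.lintegral_compProd hf]

theorem measurable_card_filter_arm {T : ℕ} (i : Fin k) : Measurable fun y : Fin T → Fin k × ℝ =>
    ((Finset.univ.filter fun s => (y s).1 = i).card : ℝ) := by
  simp only [Finset.card_filter, Nat.cast_sum]
  refine Finset.measurable_fun_sum _ fun s _ => ?_
  exact (measurable_of_countable fun a : Fin k => (((if a = i then 1 else 0 : ℕ)) : ℝ)).comp
    (measurable_pi_apply s).fst

theorem measurable_sampleCount {T : ℕ} (i : Fin k) :
    Measurable fun h : History n k T => (sampleCount h p i : ℝ) :=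
  (measurable_card_filter_arm i).comp
    (measurable_pi_lambda _ fun s => (measurable_pi_apply s).eval)

theorem sampleCount_le {T : ℕ} (h : History n k T) (i : Fin k) : sampleCount h p i ≤ T := by
  simpa [sampleCount] using Finset.card_filter_le Finset.univ fun t : Fin T => (h t p).1 = i

theorem sum_apply_arm_eq {T : ℕ} (h : History n k T) (g : Fin k → ℝ) :
    ∑ t, g (h t p).1 = ∑ i, g i * sampleCount h p i := by
  simp only [sampleCount, Finset.card_filter, Nat.cast_sum, Finset.mul_sum]
  rw [Finset.sum_comm]
  simp

theorem integrable_sampleCount (i : Fin k) (T : ℕ) :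
    Integrable (fun h => (sampleCount h p i : ℝ)) (historyLaw D F T) :=
  Integrable.of_mem_Icc 0 T (measurable_sampleCount p i).aemeasurable <|
    Eventually.of_forall fun h => ⟨Nat.cast_nonneg _, Nat.cast_le.2 (sampleCount_le p h i)⟩

theorem integral_reward_eq {T : ℕ} (t : Fin T) :
    ∫ h, (h t p).2 ∂historyLaw D F T = ∫ h, D.mean (h t p).1 ∂historyLaw D F T := by
  set ρ : Measure (Fin k) := (F p).choice t ∘ₘ historyLaw D F t
  have hround : AEMeasurable (fun h : History n k T => h t p) (historyLaw D F T) :=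
    (measurable_pi_apply t).eval.aemeasurable
  have hmean : Measurable fun z : Fin k × ℝ => D.mean z.1 :=
    (measurable_of_finite D.mean).comp measurable_fst
  have hreward : Integrable (fun z : Fin k × ℝ => z.2) (ρ ⊗ₘ D.rewardKernel) :=
    Integrable.of_mem_Icc (-1) 1 measurable_snd.aemeasurable <|
      Measure.ae_compProd_of_ae_ae (measurable_snd measurableSet_Icc) <|
        Eventually.of_forall D.support
  calc ∫ h, (h t p).2 ∂historyLaw D F T
      = ∫ z, z.2 ∂(ρ ⊗ₘ D.rewardKernel) := by
        rw [← map_round_historyLaw, integral_map hround measurable_snd.aestronglyMeasurable]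
    _ = ∫ a, D.mean a ∂ρ := Measure.integral_compProd hreward
    _ = ∫ z, D.mean z.1 ∂(ρ ⊗ₘ D.rewardKernel) := by
        rw [← integral_map measurable_fst.aemeasurable
          (measurable_of_finite D.mean).aestronglyMeasurable]
        exact congrArg (fun ρ' => ∫ a, D.mean a ∂ρ') (Measure.fst_compProd ρ _).symm
    _ = ∫ h, D.mean (h t p).1 ∂historyLaw D F T := by
        rw [← map_round_historyLaw, integral_map hround hmean.aestronglyMeasurable]

theorem sum_expectedSampleCount (T : ℕ) : ∑ i, expectedSampleCount D F p i T = T := by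
  simp only [expectedSampleCount]
  rw [← integral_finsetSum _ fun i _ => integrable_sampleCount D F p i T]
  have hsum (h : History n k T) : ∑ i, (sampleCount h p i : ℝ) = T := by
    simpa using (sum_apply_arm_eq p h fun _ => 1).symm
  simp [hsum]

theorem regret_eq_sum_gap_mul (T : ℕ) :
    regret D F p T = ∑ i, (D.bestMean - D.mean i) * expectedSampleCount D F p i T := by
  have hmean (t : Fin T) : Integrable (fun h => D.mean (h t p).1) (historyLaw D F T) :=
    (Integrable.of_finite (f := D.mean)).comp_measurable (measurable_pi_apply t).eval.fst
  have hreward : ∑ t : Fin T, ∫ h, (h t p).2 ∂historyLaw D F T =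
      ∑ i, D.mean i * expectedSampleCount D F p i T := by
    simp only [integral_reward_eq, expectedSampleCount, ← integral_const_mul]
    rw [← integral_finsetSum _ fun t _ => hmean t, ← integral_finsetSum _ fun i _ =>
      (integrable_sampleCount D F p i T).const_mul _]
    simp only [sum_apply_arm_eq p _ D.mean]
  rw [regret, hreward, ← sum_expectedSampleCount D F p T, Finset.sum_mul,
    ← Finset.sum_sub_distrib]
  exact Finset.sum_congr rfl fun i _ => by ring

variable {D F p}

theorem mul_sub_expectedSampleCount_le_regret {i : Fin k} {Δ : ℝ}
    (hΔ : ∀ j, j ≠ i → D.mean j + Δ ≤ D.mean i) (T : ℕ) :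
    Δ * (T - expectedSampleCount D F p i T) ≤ regret D F p T := by
  have hcount (j : Fin k) : 0 ≤ expectedSampleCount D F p j T :=
    integral_nonneg fun _ => Nat.cast_nonneg _
  have hbest := D.mean_le_bestMean i
  rw [regret_eq_sum_gap_mul, ← sum_expectedSampleCount D F p T,
    ← Finset.sum_erase_add _ _ (Finset.mem_univ i), add_sub_cancel_right, Finset.mul_sum,
    ← Finset.sum_erase_add _ _ (Finset.mem_univ i)]
  refine le_add_of_le_of_nonneg (Finset.sum_le_sum fun j hj => ?_)
    (mul_nonneg (sub_nonneg.2 hbest) (hcount i))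
  have hgap := hΔ j (Finset.ne_of_mem_erase hj)
  exact mul_le_mul_of_nonneg_right (by linarith) (hcount j)

variable (D F p) in
theorem sub_mul_measureReal_sampleCount_le (i : Fin k) (T : ℕ) (m : ℝ) :
    (T - m) * (historyLaw D F T).real {h | (sampleCount h p i : ℝ) ≤ m} ≤
      T - expectedSampleCount D F p i T := by
  have hint := integrable_sampleCount D F p i T
  have hmarkov := mul_meas_ge_le_integral_of_nonneg (μ := historyLaw D F T)
    (f := fun h => (T : ℝ) - sampleCount h p i)
    (Eventually.of_forall fun h => sub_nonneg.2 (Nat.cast_le.2 (sampleCount_le p h i)))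
    ((integrable_const _).sub hint) (T - m)
  rw [integral_sub (integrable_const _) hint] at hmarkov
  simp only [sub_le_sub_iff_left] at hmarkov
  simpa [expectedSampleCount] using hmarkov

variable (D F p) in
theorem mul_one_sub_measureReal_sampleCount_le (i : Fin k) (T : ℕ) {m : ℝ} (hm : 0 ≤ m) :
    m * (1 - (historyLaw D F T).real {h | (sampleCount h p i : ℝ) ≤ m}) ≤
      expectedSampleCount D F p i T := by
  have hmeas : MeasurableSet {h : History n k T | (sampleCount h p i : ℝ) ≤ m} :=
    measurableSet_le (measurable_sampleCount p i) measurable_const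
  rw [← probReal_compl_eq_one_sub hmeas]
  refine le_trans (mul_le_mul_of_nonneg_left (measureReal_mono fun h hh => ?_) hm)
    (mul_meas_ge_le_integral_of_nonneg (Eventually.of_forall fun h => Nat.cast_nonneg _)
      (integrable_sampleCount D F p i T) m)
  have hlt : m < sampleCount h p i := by simpa using hh
  exact hlt.le

/-- The law of the next action and reward of a self-reliant player with policy `f`, given her own
past actions and rewards. The policy is evaluated at the history in which all players share that
past: by self-reliance the other players' entries do not matter. -/
noncomputable def Policy.ownRound (f : Policy n k) (D : StochasticBandit k) (t : ℕ) :
    Kernel (Fin t → Fin k × ℝ) (Fin k × ℝ) :=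
  (f.choice t).comap (fun y s _ => y s) (by fun_prop) ⊗ₖ Kernel.prodMkLeft _ D.rewardKernel

instance (f : Policy n k) (t : ℕ) : IsMarkovKernel (f.ownRound D t) := by
  unfold Policy.ownRound; infer_instance

theorem Policy.ownRound_apply (f : Policy n k) {t : ℕ} (y : Fin t → Fin k × ℝ) :
    f.ownRound D t y = f.choice t (fun s _ => y s) ⊗ₘ D.rewardKernel := by
  rw [ownRound, Kernel.compProd_apply_eq_compProd_sectR, Kernel.sectR_prodMkLeft,
    Kernel.comap_apply]

theorem map_own_historyLaw (hself : (F p).SelfReliant p) (T : ℕ) :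
    (historyLaw D F T).map (fun h s => h s p) = sequentialLaw ((F p).ownRound D) T := by
  rw [historyLaw_eq_sequentialLaw]
  refine map_comp_sequentialLaw (measurable_pi_apply p) (fun t h => ?_) T
  rw [map_eval_roundKernel, Policy.ownRound_apply, hself t h (fun s _ => h s p) fun s => rfl]
  rfl

variable {D' : StochasticBandit k} {i : Fin k} {c : ℝ≥0}

theorem Policy.ownRound_le_withDensity (f : Policy n k) (hi : D.reward i ≤ c • D'.reward i)
    (hne : ∀ j, j ≠ i → D.reward j = D'.reward j) {t : ℕ} (y : Fin t → Fin k × ℝ) :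
    f.ownRound D t y ≤
      (f.ownRound D' t y).withDensity fun z => if z.1 = i then (c : ℝ≥0∞) else 1 := by
  rw [ownRound_apply, ownRound_apply]
  refine compProd_le_withDensity _ (v := fun a => if a = i then (c : ℝ≥0∞) else 1)
    (measurable_of_finite _) fun a => ?_
  change D.reward a ≤ _ • D'.reward a
  split_ifs with ha
  · exact ha ▸ hi
  · rw [one_smul, hne a ha]

theorem map_own_historyLaw_le_withDensity (hself : (F p).SelfReliant p)
    (hi : D.reward i ≤ c • D'.reward i) (hne : ∀ j, j ≠ i → D.reward j = D'.reward j) (T : ℕ) :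
    (historyLaw D F T).map (fun h s => h s p) ≤
      ((historyLaw D' F T).map fun h s => h s p).withDensity
        fun y => (c : ℝ≥0∞) ^ (Finset.univ.filter fun s => (y s).1 = i).card := by
  rw [map_own_historyLaw hself, map_own_historyLaw hself]
  convert sequentialLaw_le_withDensity
    ((measurable_of_finite fun a : Fin k => if a = i then (c : ℝ≥0∞) else 1).comp measurable_fst)
    (fun t y => (F p).ownRound_le_withDensity hi hne y) T using 3 with y
  simp [Finset.prod_ite]

theorem measureReal_sampleCount_le_rpow_mul (hself : (F p).SelfReliant p)
    (hi : D.reward i ≤ c • D'.reward i) (hne : ∀ j, j ≠ i → D.reward j = D'.reward j)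
    (T : ℕ) (m : ℝ) :
    (historyLaw D F T).real {h | (sampleCount h p i : ℝ) ≤ m} ≤
      (c : ℝ) ^ m * (historyLaw D' F T).real {h | (sampleCount h p i : ℝ) ≤ m} := by
  have hc : 1 ≤ c := by
    have huniv := hi Set.univ
    rw [Measure.smul_apply, measure_univ, measure_univ, ENNReal.smul_def, smul_eq_mul, mul_one]
      at huniv
    exact ENNReal.one_le_coe_iff.1 huniv
  have hown : Measurable fun (h : History n k T) s => h s p := by fun_prop
  let A : Set (Fin T → Fin k × ℝ) :=
    {y | ((Finset.univ.filter fun s => (y s).1 = i).card : ℝ) ≤ m}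
  have hA : MeasurableSet A :=
    measurableSet_le (measurable_card_filter_arm i) measurable_const
  have hlintegral : historyLaw D F T {h | (sampleCount h p i : ℝ) ≤ m} ≤
      (c : ℝ≥0∞) ^ m * historyLaw D' F T {h | (sampleCount h p i : ℝ) ≤ m} := by
    calc historyLaw D F T {h | (sampleCount h p i : ℝ) ≤ m}
        = (historyLaw D F T).map (fun h s => h s p) A := (Measure.map_apply hown hA).symm
      _ ≤ ∫⁻ y in A, (c : ℝ≥0∞) ^ (Finset.univ.filter fun s => (y s).1 = i).card
            ∂(historyLaw D' F T).map fun h s => h s p := by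
          rw [← withDensity_apply _ hA]
          exact map_own_historyLaw_le_withDensity hself hi hne T A
      _ ≤ ∫⁻ _ in A, (c : ℝ≥0∞) ^ m ∂(historyLaw D' F T).map fun h s => h s p := by
          refine setLIntegral_mono measurable_const fun y hy => ?_
          rw [← ENNReal.rpow_natCast]
          exact ENNReal.rpow_le_rpow_of_exponent_le (ENNReal.one_le_coe_iff.2 hc) hy
      _ = (c : ℝ≥0∞) ^ m * historyLaw D' F T {h | (sampleCount h p i : ℝ) ≤ m} := by
          rw [setLIntegral_const, Measure.map_apply hown hA]
          rfl
  simpa [measureReal_def, ← ENNReal.toReal_rpow] using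
    ENNReal.toReal_mono (by finiteness) hlintegral

theorem isBigO_measureReal_sampleCount_le (hi : ∀ j, j ≠ i → D.mean j < D.mean i) {m : ℕ → ℝ}
    (hm : m =o[atTop] fun T => (T : ℝ)) :
    (fun T => (historyLaw D F T).real {h | (sampleCount h p i : ℝ) ≤ m T}) =O[atTop]
      fun T => regret D F p T / T := by
  obtain ⟨Δ, hΔ, hgap⟩ := StochasticBandit.exists_pos_forall_mean_add_le hi
  refine IsBigO.of_bound (2 / Δ) ?_
  filter_upwards [hm.bound (half_pos one_pos), eventually_gt_atTop 0] with T hmT hT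
  have hT0 : (0 : ℝ) < T := Nat.cast_pos.2 hT
  set P := (historyLaw D F T).real {h | (sampleCount h p i : ℝ) ≤ m T}
  have hP : 0 ≤ P := measureReal_nonneg
  have hhalf : (T : ℝ) / 2 ≤ T - m T := by
    rw [Real.norm_natCast] at hmT
    linarith [Real.le_norm_self (m T)]
  have hregret : Δ * (T / 2 * P) ≤ regret D F p T :=
    calc Δ * (T / 2 * P) ≤ Δ * ((T - m T) * P) := by gcongr
      _ ≤ Δ * (T - expectedSampleCount D F p i T) := by
          gcongr
          exact sub_mul_measureReal_sampleCount_le D F p i T (m T)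
      _ ≤ regret D F p T := mul_sub_expectedSampleCount_le_regret hgap T
  calc ‖P‖ = 2 / Δ * (Δ * (T / 2 * P) / T) := by rw [Real.norm_of_nonneg hP]; field_simp
    _ ≤ 2 / Δ * (regret D F p T / T) := by gcongr
    _ ≤ 2 / Δ * ‖regret D F p T / T‖ := by gcongr; exact Real.le_norm_self _

theorem isBigO_expectedSampleCount_of_tendsto {m : ℕ → ℝ} (hm : ∀ T, 0 ≤ m T)
    (hP : Tendsto (fun T => (historyLaw D F T).real {h | (sampleCount h p i : ℝ) ≤ m T}) atTop
      (𝓝 0)) :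
    m =O[atTop] fun T => expectedSampleCount D F p i T := by
  refine IsBigO.of_bound 2 ?_
  filter_upwards [hP.eventually_le_const (half_pos one_pos)] with T hPT
  have hcount := mul_one_sub_measureReal_sampleCount_le D F p i T (hm T)
  have hhalf : m T * (1 / 2) ≤ expectedSampleCount D F p i T :=
    (mul_le_mul_of_nonneg_left (by linarith) (hm T)).trans hcount
  rw [Real.norm_of_nonneg (hm T)]
  linarith [Real.le_norm_self (expectedSampleCount D F p i T)]

theorem tendsto_measureReal_sampleCount_le_logb (hself : (F p).SelfReliant p) (hc : 1 < c)
    (hi : D.reward i ≤ c • D'.reward i) (hne : ∀ j, j ≠ i → D.reward j = D'.reward j)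
    (hbest : ∀ j, j ≠ i → D'.mean j < D'.mean i) {ε δ : ℝ} (hδ : δ < ε)
    (hregret : (fun T => regret D' F p T) =O[atTop] fun T => (T : ℝ) ^ (1 - ε)) :
    Tendsto (fun T => (historyLaw D F T).real {h | (sampleCount h p i : ℝ) ≤ δ * Real.logb c T})
      atTop (𝓝 0) := by
  have hc0 : (0 : ℝ) < c := zero_lt_one.trans hc
  have hm : (fun T : ℕ => δ * Real.logb c T) =o[atTop] fun T => (T : ℝ) :=
    (Real.isLittleO_logb_id_atTop.comp_tendsto tendsto_natCast_atTop_atTop).const_mul_left _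
  have hD' : (fun T => (historyLaw D' F T).real {h | (sampleCount h p i : ℝ) ≤ δ * Real.logb c T})
      =O[atTop] fun T => (T : ℝ) ^ (1 - ε) / T := by
    simpa only [div_eq_mul_inv] using (isBigO_measureReal_sampleCount_le hbest hm).trans
      (hregret.mul (isBigO_refl (fun T : ℕ => (T : ℝ)⁻¹) atTop))
  have hratio : (fun T => (historyLaw D F T).real {h | (sampleCount h p i : ℝ) ≤ δ * Real.logb c T})
      =O[atTop] fun T => (c : ℝ) ^ (δ * Real.logb c T) *
        (historyLaw D' F T).real {h | (sampleCount h p i : ℝ) ≤ δ * Real.logb c T} :=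
    IsBigO.of_norm_le fun T => by
      rw [Real.norm_of_nonneg measureReal_nonneg]
      exact measureReal_sampleCount_le_rpow_mul hself hi hne T _
  have hpow : (fun T : ℕ => (c : ℝ) ^ (δ * Real.logb c T) * ((T : ℝ) ^ (1 - ε) / T)) =ᶠ[atTop]
      fun T => (T : ℝ) ^ (-(ε - δ)) := by
    filter_upwards [eventually_gt_atTop 0] with T hT
    have hT0 : (0 : ℝ) < T := Nat.cast_pos.2 hT
    rw [mul_comm δ, Real.rpow_mul hc0.le, Real.rpow_logb hc0 (ne_of_gt hc) hT0,
      ← Real.rpow_sub_one hT0.ne', ← Real.rpow_add hT0]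
    congr 1
    ring
  exact (hratio.trans (((isBigO_refl _ _).mul hD').trans_eventuallyEq hpow)).trans_tendsto
    ((tendsto_rpow_neg_atTop (sub_pos.2 hδ)).comp tendsto_natCast_atTop_atTop)

theorem log_isBigO_expectedSampleCount_of_regret (hself : (F p).SelfReliant p) (hc : 1 < c)
    (hi : D.reward i ≤ c • D'.reward i) (hne : ∀ j, j ≠ i → D.reward j = D'.reward j)
    (hbest : ∀ j, j ≠ i → D'.mean j < D'.mean i) {ε : ℝ} (hε : 0 < ε)
    (hregret : (fun T => regret D' F p T) =O[atTop] fun T => (T : ℝ) ^ (1 - ε)) :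
    (fun T : ℕ => Real.log T) =O[atTop] fun T => expectedSampleCount D F p i T := by
  have hm0 (T : ℕ) : 0 ≤ ε / 2 * Real.logb c T :=
    mul_nonneg (half_pos hε).le (div_nonneg (Real.log_natCast_nonneg T) (Real.log_pos hc).le)
  have hlog : (fun T : ℕ => Real.log T) =O[atTop] fun T => ε / 2 * Real.logb c T := by
    have hlogb (T : ℕ) : Real.log T = Real.log c / (ε / 2) * (ε / 2 * Real.logb c T) := by
      have hlogc : Real.log c ≠ 0 := (Real.log_pos hc).ne'
      rw [Real.logb]
      field_simp
    exact (isBigO_const_mul_self _ _ _).congr_left fun T => (hlogb T).symm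
  exact hlog.trans <| isBigO_expectedSampleCount_of_tendsto hm0 <|
    tendsto_measureReal_sampleCount_le_logb hself hc hi hne hbest (half_lt_self hε) hregret

end Play

theorem theorem1 {n k : ℕ} (F : Fin n → Policy n k) (p : Fin n)
    (hself : (F p).SelfReliant p)
    (ε : ℝ) (hε : 0 < ε)
    (hregret : ∀ D : StochasticBandit k,
      (fun T : ℕ => regret D F p T) =O[atTop] (fun T : ℕ => (T : ℝ) ^ (1 - ε)))
    (D : StochasticBandit k) (hD : D.bestMean < 1) (i : Fin k) :
    (fun T : ℕ => Real.log (T : ℝ)) =O[atTop] (fun T : ℕ => expectedSampleCount D F p i T) := by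
  obtain ⟨D', c, hc, hbest, hi, hne⟩ := StochasticBandit.exists_dominating_bandit hD i
  exact log_isBigO_expectedSampleCount_of_regret hself hc hi hne hbest hε (hregret D')
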